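/- **Setting.** Let $c_H<0<c_S$ and $\mathcal P=\mathbb E^{d_E}\times\mathbb H^{d_H}_{c_H}\times\mathbb S^{d_S}_{c_S}$ be the product of Euclidean space, hyperbolic space (Poincaré ball) of curvature $c_H$ and the sphere of curvature $c_S$, with the $\ell_2$ product $d_{\mathcal P}$ of the three geodesic distances. Let the data manifold $\mathcal M\subset\mathcal P$ be a measurable set contained in a geodesic ball of radius $R$, with metric $d_{\mathcal P}$, let $Y$ be a finite label set, $\mu$ (real data) a probability distribution on $\mathcal M\times Y$ and $(\nu_N)_N$ (distilled data of size $N$) a sequence of such distributions. Data are matched either in $\mathcal P$, with representation $\Phi_{\rm prod}$ the inclusion $\mathcal M\hookrightarrow\mathcal P$, or in $\mathbb R^m$ with the Euclidean metric, with a representation $\Phi_{\rm euc}:\mathcal M\to\mathbb R^m$. For each matching space $(X,d_X)$ with representation $\Phi$ let $f_\theta$ be predictors on $X$, $\ell$ a loss, $\rho\mapsto\theta^\rho$ a training algorithm, $\mathcal R(\theta;\rho)=\mathbb E_{(x,y)\sim\rho}\,\ell(f_\theta(\Phi(x)),y)$ the population risk, and $\Delta=|\mathcal R(\theta^{\nu_N};\mu)-\mathcal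 R(\theta^{\mu};\mu)|$ the generalization gap. Assume in both spaces, with the same constants $L,\varepsilon_{\rm stab},\varepsilon_{\rm opt}\ge 0$ and $\mathcal E^{(y)}_{\rm stat}(N)\ge0$, that $\Phi$ is measurable and that * $|\ell(f_\theta(z),y)-\ell(f_\theta(z'),y)|\le L\,d_X(z,z')$ for all $\theta,y,z,z'$; * $|\mathcal R(\theta^{\rho_1};\mu)-\mathcal R(\theta^{\rho_2};\mu)|\le\varepsilon_{\rm stab}$ for all $\rho_1,\rho_2$; * $\mathrm{IPM}^{(X)}(\Phi_\#\mu(\cdot|y),\Phi_\#\nu_N(\cdot|y))\le\mathcal E^{(y)}_{\rm stat}(N)+\varepsilon_{\rm opt}$ for all $N$ and all labels $y$ of positive probability under both $\mu$ and $\nu_N$, with $\mathcal E^{(y)}_{\rm stat}(N)\to0$ for each $y$, for an integral probability metric generated by a class of measurable test functions that are bounded on bounded sets (for example $W_1$). Let $(\beta_{\rm euc},\varepsilon_{\rm euc})$ be distortion constants of $\Phi_{\rm euc}$, that is, $\beta_{\rm euc}\ge1$, $\varepsilon_{\rm euc}\ge0$ and $\|\Phi_{\rm euc}(x)-\Phi_{\rm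 euc}(x')\|\le\beta_{\rm euc}d_{\mathcal P}(x,x')+\varepsilon_{\rm euc}$ on $\mathcal M$. Let $C>0$ be the constant of the IPM, put $S=\sum_y\mu_y\mathcal E^{(y)}_{\rm stat}(N)+\varepsilon_{\rm opt}$ with $\mu_y$ the prior of the label $y$, assume $S>0$, and let $$U(\beta,\varepsilon)=L(\beta S+C\varepsilon)+\varepsilon_{\rm stab}$$ be the risk bound. **Theorem (product spaces yield tighter bounds).** Given $d_E,d_H,d_S,m,c_H,c_S$, non-collapse constants $A,\gamma,\Delta_0,\rho,\alpha_0>0$ and $1<\eta<\pi/2$, there are $R_0,\sigma>0$, depending only on these numbers, such that the following holds in every such setting. Consider the conditions * (H) $R\ge R_0$, and either (uniform separation) $\mathcal M$ contains at least $Ae^{\gamma R}$ points whose images under $\Phi_{\rm euc}$ are pairwise at distance at least $\Delta_0$, or (co-Lipschitz) $d_H\ge2$ and $\mathcal M$ contains a hyperbolic ball $\{e\}\times B_{\mathbb H}(o,\rho R)\times\{s\}$ on which $\|\Phi_{\rm euc}(x)-\Phi_{\rm euc}(x')\|\ge\alpha_0^{-1}d_{\mathcal P}(x,x')$; * (S)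 $d_S\ge1$ and $\mathcal M$ contains a sphere $\{e\}\times\{h\}\times\mathbb S^{d_S}_{c_S}$ on which $\|\Phi_{\rm euc}(x)-\Phi_{\rm euc}(x')\|\ge d_{\mathcal P}(x,x')$. The inclusion into $\mathcal P$ has distortion constants $\beta_{\rm prod}=1$, $\varepsilon_{\rm prod}=0$, while (H) implies $\beta_{\rm euc}\ge1+R$ or $\varepsilon_{\rm euc}\ge R$, and (S) implies $\beta_{\rm euc}\ge\eta$ or $\varepsilon_{\rm euc}\ge\sigma$. If (H) or (S) holds, then $\Delta_{\rm euc}\le U(\beta_{\rm euc},\varepsilon_{\rm euc})$ and there is $\delta>0$ with $$\Delta_{\rm prod}\;\le\;U(1,0)\;\le\;U(\beta_{\rm euc},\varepsilon_{\rm euc})-L\,\delta,$$ where $\delta\ge R\min(S,C)$ if (H) holds, and $\delta\ge\min((\eta-1)S,\sigma C)$ if (S) holds. -/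

import Mathlib

open MeasureTheory ProbabilityTheory Filter Topology
open scoped ENNReal

noncomputable section

/-! ### The three constant-curvature model spaces and their product -/

/-- Hyperbolic space of dimension `n` and curvature `c < 0`: the Poincare ball of radius
`1 / √(-c)`. -/
abbrev HypSpace (n : ℕ) (c : ℝ) : Type :=
  {z : EuclideanSpace ℝ (Fin n) // ‖z‖ < 1 / √(-c)}

/-- Geodesic distance of the Poincare ball with conformal factor `2 / (1 + c ‖z‖²)`, i.e.
`cosh (√(-c) d) = 1 + 2 (-c) ‖x - y‖² / ((1 + c ‖x‖²) (1 + c ‖y‖²))`. -/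
def hypDist {n : ℕ} {c : ℝ} (x y : HypSpace n c) : ℝ :=
  2 / √(-c) * Real.arsinh
    (√(-c) * ‖x.1 - y.1‖ / √((1 + c * ‖x.1‖ ^ 2) * (1 + c * ‖y.1‖ ^ 2)))

/-- The sphere of dimension `n` and curvature `c > 0`, of radius `1 / √c` in `ℝ^(n+1)`. -/
abbrev SphSpace (n : ℕ) (c : ℝ) : Type :=
  {z : EuclideanSpace ℝ (Fin (n + 1)) // inner ℝ z z = 1 / c}

/-- Geodesic (great-circle) distance of the sphere of curvature `c`: radius times angle. -/
def sphDist {n : ℕ} {c : ℝ} (x y : SphSpace n c) : ℝ :=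
  1 / √c * InnerProductGeometry.angle x.1 y.1

/-- The mixed-curvature product `E^dE × H^dH × S^dS`. -/
abbrev ProdSpace (dE dH dS : ℕ) (cH cS : ℝ) : Type :=
  EuclideanSpace ℝ (Fin dE) × HypSpace dH cH × SphSpace dS cS

/-- The `ℓ²` product of the three geodesic distances. -/
def prodDist {dE dH dS : ℕ} {cH cS : ℝ} (x y : ProdSpace dE dH dS cH cS) : ℝ :=
  √(dist x.1 y.1 ^ 2 + hypDist x.2.1 y.2.1 ^ 2 + sphDist x.2.2 y.2.2 ^ 2)

/-- `𝓜` is contained in a geodesic ball of radius `R`. -/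
def InGeodesicBall {dE dH dS : ℕ} {cH cS : ℝ} (𝓜 : Set (ProdSpace dE dH dS cH cS)) (R : ℝ) :
    Prop :=
  ∃ o : ProdSpace dE dH dS cH cS, ∀ x ∈ 𝓜, prodDist o x ≤ R

/-- Geodesic distance of the ambient product on the data manifold. -/
def dataDist {dE dH dS : ℕ} {cH cS : ℝ} (𝓜 : Set (ProdSpace dE dH dS cH cS)) (x y : 𝓜) : ℝ :=
  prodDist x.1 y.1

/-- `(β, ε)` are (multiplicative, additive) distortion constants of `Φ : M → X`. The
multiplicative factor is normalized to be at least `1`, its value for an isometry. -/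
def IsDistortion {M X : Type*} (dM : M → M → ℝ) (dX : X → X → ℝ) (Φ : M → X) (β ε : ℝ) : Prop :=
  1 ≤ β ∧ 0 ≤ ε ∧ ∀ x x' : M, dX (Φ x) (Φ x') ≤ β * dM x x' + ε

/-! ### Integral probability metrics -/

/-- The generating class of an integral probability metric on `(X, dX)`: measurable test functions,
bounded on bounded sets. All `1`-Lipschitz functions generate the Wasserstein distance `W₁`, the
unit ball of a reproducing kernel Hilbert space generates a maximum mean discrepancy. -/
structure TestClass (X : Type*) [MeasurableSpace X] (dX : X → X → ℝ) where
  carrier : Set (X → ℝ)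
  measurable : ∀ g ∈ carrier, Measurable g
  bounded : ∀ g ∈ carrier, ∀ (x₀ : X) (r : ℝ), ∃ B : ℝ, ∀ x, dX x₀ x ≤ r → |g x| ≤ B

/-- The integral probability metric generated by `𝓕`. -/
def ipm {X : Type*} [MeasurableSpace X] {dX : X → X → ℝ} (𝓕 : TestClass X dX)
    (ρ₁ ρ₂ : Measure X) : ℝ≥0∞ :=
  ⨆ g ∈ 𝓕.carrier, ENNReal.ofReal |∫ x, g x ∂ρ₁ - ∫ x, g x ∂ρ₂|

/-! ### Distillation in a matching space -/

/-- The prior of the label `y`. -/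
def labelPrior {M Y : Type*} [MeasurableSpace M] [MeasurableSpace Y]
    (ρ : ProbabilityMeasure (M × Y)) (y : Y) : ℝ :=
  (ρ : Measure (M × Y)).real (Prod.snd ⁻¹' {y})

/-- The class-conditional law `ρ(· | y)` on the data manifold (meaningful if the prior of `y` is
positive). -/
def classLaw {M Y : Type*} [MeasurableSpace M] [MeasurableSpace Y]
    (ρ : ProbabilityMeasure (M × Y)) (y : Y) : Measure M :=
  ((ρ : Measure (M × Y))[|Prod.snd ⁻¹' {y}]).map Prod.fst

/-- Distillation in the matching space `X`: a representation map `Φ : M → X`, predictors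
`f_θ : X → O`, a loss `ℓ(f_θ(z), y)`, and a training algorithm `ρ ↦ θ^ρ`. -/
structure MatchingModel (M X Y Θ O : Type*) [MeasurableSpace M] [MeasurableSpace Y] where
  rep : M → X
  model : Θ → X → O
  loss : O → Y → ℝ
  train : ProbabilityMeasure (M × Y) → Θ

namespace MatchingModel

variable {M X Y Θ O : Type*} [MeasurableSpace M] [MeasurableSpace Y]

/-- Population risk of `θ` under `ρ`. -/
def risk (G : MatchingModel M X Y Θ O) (θ : Θ) (ρ : ProbabilityMeasure (M × Y)) : ℝ :=
  ∫ p, G.loss (G.model θ (G.rep p.1)) p.2 ∂(ρ : Measure (M × Y))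

/-- The generalization gap `Δ = |R(θ^ν; μ) - R(θ^μ; μ)|`. -/
def gap (G : MatchingModel M X Y Θ O) (μ ν : ProbabilityMeasure (M × Y)) : ℝ :=
  |G.risk (G.train ν) μ - G.risk (G.train μ) μ|

/-- Regularity and convergence: Lipschitz loss, algorithmic stability, and class-wise statistical
convergence of the distilled distributions `ν N` of size `N`. -/
structure Regular [MeasurableSpace X] {dX : X → X → ℝ} (G : MatchingModel M X Y Θ O)
    (𝓕 : TestClass X dX) (μ : ProbabilityMeasure (M × Y)) (ν : ℕ → ProbabilityMeasure (M × Y))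
    (L εstab εopt : ℝ) (Estat : Y → ℕ → ℝ) : Prop where
  measurable_rep : Measurable G.rep
  lipschitz : ∀ (θ : Θ) (y : Y) (z z' : X),
    |G.loss (G.model θ z) y - G.loss (G.model θ z') y| ≤ L * dX z z'
  stable : ∀ ρ₁ ρ₂ : ProbabilityMeasure (M × Y),
    |G.risk (G.train ρ₁) μ - G.risk (G.train ρ₂) μ| ≤ εstab
  stat : ∀ (y : Y) (N : ℕ), labelPrior μ y ≠ 0 → labelPrior (ν N) y ≠ 0 →
    ipm 𝓕 ((classLaw μ y).map G.rep) ((classLaw (ν N) y).map G.rep)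
      ≤ ENNReal.ofReal (Estat y N + εopt)
  stat_tendsto : ∀ y : Y, Tendsto (Estat y) atTop (𝓝 0)

end MatchingModel

/-- The class-weighted average statistical error plus the optimization error. -/
def statError {M Y : Type*} [MeasurableSpace M] [MeasurableSpace Y] [Fintype Y]
    (μ : ProbabilityMeasure (M × Y)) (Estat : Y → ℕ → ℝ) (εopt : ℝ) (N : ℕ) : ℝ :=
  ∑ y, labelPrior μ y * Estat y N + εopt

/-- The risk bound `L (β S + C ε) + ε_stab`. -/
def riskBound (L β S C ε εstab : ℝ) : ℝ := L * (β * S + C * ε) + εstab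

/-! ### Non-collapse of a Euclidean representation -/

/-- Uniform separation: at least `A e^(γ R)` points of the data manifold have images that are
pairwise at distance at least `Δ`. -/
def UniformlySeparates {dE dH dS m : ℕ} {cH cS : ℝ} {𝓜 : Set (ProdSpace dE dH dS cH cS)}
    (Φ : 𝓜 → EuclideanSpace ℝ (Fin m)) (A γ Δ R : ℝ) : Prop :=
  ∃ T : Finset 𝓜, A * Real.exp (γ * R) ≤ (T.card : ℝ) ∧
    ∀ u ∈ T, ∀ v ∈ T, u ≠ v → Δ ≤ dist (Φ u) (Φ v)

/-- The data manifold contains a hyperbolic ball of radius `ρ R` (in a slice, in dimension at least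
two), on which `Φ` is co-Lipschitz with constant `α₀`. -/
def HypCoLipschitz {dE dH dS m : ℕ} {cH cS : ℝ} {𝓜 : Set (ProdSpace dE dH dS cH cS)}
    (Φ : 𝓜 → EuclideanSpace ℝ (Fin m)) (ρ α₀ R : ℝ) : Prop :=
  2 ≤ dH ∧ ∃ (e : EuclideanSpace ℝ (Fin dE)) (o : HypSpace dH cH) (s : SphSpace dS cS),
    (∀ h : HypSpace dH cH, hypDist o h ≤ ρ * R → (e, h, s) ∈ 𝓜) ∧
    ∀ (h h' : HypSpace dH cH) (hh : (e, h, s) ∈ 𝓜) (hh' : (e, h', s) ∈ 𝓜),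
      hypDist o h ≤ ρ * R → hypDist o h' ≤ ρ * R →
        α₀⁻¹ * hypDist h h' ≤ dist (Φ ⟨(e, h, s), hh⟩) (Φ ⟨(e, h', s), hh'⟩)

/-- The data manifold contains a whole spherical slice (of dimension at least one), on which `Φ`
does not contract geodesic distances. -/
def SphNoncontracting {dE dH dS m : ℕ} {cH cS : ℝ} {𝓜 : Set (ProdSpace dE dH dS cH cS)}
    (Φ : 𝓜 → EuclideanSpace ℝ (Fin m)) : Prop :=
  1 ≤ dS ∧ ∃ (e : EuclideanSpace ℝ (Fin dE)) (h : HypSpace dH cH),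
    ∃ hs : ∀ s : SphSpace dS cS, (e, h, s) ∈ 𝓜,
      ∀ s s' : SphSpace dS cS,
        sphDist s s' ≤ dist (Φ ⟨(e, h, s), hs s⟩) (Φ ⟨(e, h, s'), hs s'⟩)

end

/-!
Stability bounds both generalization gaps by `εstab`, and the risk bounds of the two matching spaces
differ by `L * ((β - 1) * S + C * ε)`, so everything rests on lower bounds for the distortion
constants `(β, ε)` of the Euclidean representation.

*Hyperbolic non-collapse.* The data manifold has diameter at most `2 R` (`prodDist_le_two_mul`); the
triangle inequality of the Poincare ball needed here is Ptolemy's inequality for three points and the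
inverse point of the middle one (`norm_sub_mul_le_ballCochord`). If `β < 1 + R` and `ε < R`, the image
has diameter at most `(1 + R) * (2 * R) + R`, so by volume it has only polynomially many separated
points (`card_le_of_separated_of_dist_le`), which contradicts uniform separation for large `R`. A
co-Lipschitz map of a hyperbolic ball of dimension at least two is uniformly separating, because the
ball contains exponentially many separated points (`exists_separated_hypDist`): they are written down
explicitly on a circle about the origin and moved to the given centre by an inversion.

*Spherical non-collapse.* On a closed `2 h`-gon inscribed in a great circle, the diagonals
`g j = Φ (p j) - Φ (p (j + h))` have norm at least the distance `π r` of antipodal points, `r` being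
the radius of the sphere, and turn from `g 0` to `g h = -g 0` in `h` steps. Some step thus turns by at
least `π / h`, which bounds the step length `β (π r / h) + ε` below by `π r sin (π / (2 h))`
(`mul_sin_le_of_closed_polygon`). As `h → ∞` this forces `β ≥ π / 2` up to a multiple of `ε`; fixing
`h` suitably for `η < π / 2` gives `σ`.
-/

/-! ### Separated sets in Euclidean space -/

/-- Volume bound for separated sets: the balls of radius `Δ / 2` about the points are disjoint and
lie in a ball of radius `D + Δ / 2`. -/
theorem card_le_of_separated_of_dist_le {m : ℕ} {ι : Type*} (T : Finset ι)
    (f : ι → EuclideanSpace ℝ (Fin m)) {Δ D : ℝ} (hΔ : 0 < Δ) (hD : 0 ≤ D)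
    (hsep : ∀ u ∈ T, ∀ v ∈ T, u ≠ v → Δ ≤ dist (f u) (f v))
    (hdiam : ∀ u ∈ T, ∀ v ∈ T, dist (f u) (f v) ≤ D) :
    (T.card : ℝ) ≤ (1 + 2 * D / Δ) ^ m := by
  classical
  rcases T.eq_empty_or_nonempty with rfl | ⟨t₀, ht₀⟩
  · simp only [Finset.card_empty, Nat.cast_zero]
    positivity
  have hρ : 0 < D + Δ / 2 := by positivity
  have hdisj : Set.Pairwise (T : Set ι)
      (Function.onFun Disjoint fun u => Metric.ball (f u) (Δ / 2)) := by
    intro u hu v hv huv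
    apply Metric.ball_disjoint_ball
    have := hsep u hu v hv huv
    linarith
  have hsub : (⋃ u ∈ T, Metric.ball (f u) (Δ / 2)) ⊆ Metric.ball (f t₀) (D + Δ / 2) := by
    refine Set.iUnion₂_subset fun u hu => Metric.ball_subset_ball' ?_
    have := hdiam u hu t₀ ht₀
    linarith
  have hI := measure_mono (μ := (volume : Measure (EuclideanSpace ℝ (Fin m)))) hsub
  rw [measure_biUnion_finset hdisj fun _ _ => measurableSet_ball] at hI
  simp only [Measure.addHaar_ball_of_pos _ _ (half_pos hΔ), Measure.addHaar_ball_of_pos _ _ hρ,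
    Finset.sum_const, nsmul_eq_mul, ← mul_assoc, finrank_euclideanSpace_fin] at hI
  have hJ := (ENNReal.mul_le_mul_iff_left
    (Metric.measure_ball_pos _ _ zero_lt_one).ne' measure_ball_lt_top.ne).1 hI
  have hK := ENNReal.toReal_le_of_le_ofReal (pow_nonneg hρ.le _) hJ
  rw [ENNReal.toReal_mul, ENNReal.toReal_natCast, ENNReal.toReal_ofReal (by positivity)] at hK
  have : (1 + 2 * D / Δ) = (D + Δ / 2) / (Δ / 2) := by field_simp; ring
  rw [this, div_pow, le_div_iff₀ (by positivity)]
  exact hK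

/-- A polynomial in `R` is eventually smaller than an exponential in `R`. -/
theorem eventually_packing_bound_lt_exp (m : ℕ) {A γ Δ : ℝ} (hA : 0 < A) (hγ : 0 < γ)
    (hΔ : 0 < Δ) :
    ∀ᶠ R : ℝ in atTop,
      (1 + 2 * ((1 + R) * (2 * R) + R) / Δ) ^ m < A * Real.exp (γ * R) := by
  -- for `R ≥ 1` the base is at most `(1 + 10 / Δ) * R ^ 2`
  have hlim : Tendsto (fun R : ℝ => (1 + 10 / Δ) ^ m * (R ^ (2 * m : ℕ) * Real.exp (-γ * R)))
      atTop (𝓝 0) := by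
    have := (Real.tendsto_pow_mul_exp_neg_atTop_nhds_zero (2 * m)).comp
      (tendsto_id.const_mul_atTop hγ)
    have h2 := this.const_mul ((1 + 10 / Δ) ^ m * (γ⁻¹) ^ (2 * m))
    simp only [mul_zero] at h2
    refine h2.congr fun R => ?_
    simp only [Function.comp, id, mul_pow, neg_mul]
    have : γ⁻¹ ^ (2 * m) * γ ^ (2 * m) = 1 := by
      rw [← mul_pow, inv_mul_cancel₀ hγ.ne', one_pow]
    linear_combination ((1 + 10 / Δ) ^ m * R ^ (2 * m) * Real.exp (-(γ * R))) * this
  filter_upwards [hlim.eventually_lt_const hA, eventually_ge_atTop 1] with R hR h1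
  have hbase : (1 + 2 * ((1 + R) * (2 * R) + R) / Δ) ≤ (1 + 10 / Δ) * R ^ 2 := by
    have h : 2 * ((1 + R) * (2 * R) + R) / Δ ≤ 10 * R ^ 2 / Δ := by
      apply div_le_div_of_nonneg_right _ hΔ.le
      nlinarith
    have h' : 10 * R ^ 2 / Δ = 10 / Δ * R ^ 2 := by ring
    nlinarith
  have hpos : 0 ≤ 1 + 2 * ((1 + R) * (2 * R) + R) / Δ := by positivity
  calc _ ≤ ((1 + 10 / Δ) * R ^ 2) ^ m := pow_le_pow_left₀ hpos hbase m
    _ = (1 + 10 / Δ) ^ m * (R ^ (2 * m) * Real.exp (-γ * R)) * Real.exp (γ * R) := by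
        rw [mul_pow, ← pow_mul, mul_assoc, mul_assoc, ← Real.exp_add]
        simp
    _ < A * Real.exp (γ * R) := by gcongr

/-! ### The unit-ball chord -/

section Chord

variable {E : Type*} [NormedAddCommGroup E]

/-- The hyperbolic sine of half the distance of two points of the Poincare ball of
curvature `-1`. -/
noncomputable def ballChord (u v : E) : ℝ :=
  ‖u - v‖ / √((1 - ‖u‖ ^ 2) * (1 - ‖v‖ ^ 2))

theorem ballChord_nonneg (u v : E) : 0 ≤ ballChord u v := by
  unfold ballChord; positivity

theorem one_sub_norm_sq_pos {u : E} (hu : ‖u‖ < 1) : 0 < 1 - ‖u‖ ^ 2 := by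
  nlinarith [norm_nonneg u]

/-- The numerator of the hyperbolic cosine of half the distance. -/
noncomputable def ballCochord (u v : E) : ℝ :=
  √((1 - ‖u‖ ^ 2) * (1 - ‖v‖ ^ 2) + ‖u - v‖ ^ 2)

theorem ballCochord_comm (u v : E) : ballCochord u v = ballCochord v u := by
  unfold ballCochord; rw [norm_sub_rev, mul_comm]

theorem sqrt_one_add_ballChord_sq {u v : E} (hu : ‖u‖ < 1) (hv : ‖v‖ < 1) :
    √(1 + ballChord u v ^ 2) = ballCochord u v / √((1 - ‖u‖ ^ 2) * (1 - ‖v‖ ^ 2)) := by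
  have h := mul_pos (one_sub_norm_sq_pos hu) (one_sub_norm_sq_pos hv)
  unfold ballChord ballCochord
  rw [← Real.sqrt_div' _ h.le, div_pow, Real.sq_sqrt h.le, add_div, div_self h.ne']

variable [InnerProductSpace ℝ E]

/-- The cochord is a rescaled distance to the inverse point of `v` in the unit sphere. -/
theorem ballCochord_eq_norm_mul_dist (u : E) {v : E} (hv : v ≠ 0) :
    ballCochord u v = ‖v‖ * dist u ((‖v‖ ^ 2)⁻¹ • v) := by
  have hv' : ‖v‖ ≠ 0 := norm_ne_zero_iff.2 hv
  unfold ballCochord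
  rw [← Real.sqrt_sq (by positivity : 0 ≤ ‖v‖ * dist u ((‖v‖ ^ 2)⁻¹ • v)), mul_pow,
    dist_eq_norm, norm_sub_sq_real, norm_sub_sq_real, inner_smul_right, norm_smul, norm_inv,
    norm_pow, norm_norm]
  congr 1
  field_simp
  ring

/-- Ptolemy's inequality for `u`, `v`, `w` and the inverse point of `v`; it expresses the
hyperbolic triangle inequality through the addition formula of `sinh`. -/
theorem norm_sub_mul_le_ballCochord (u w : E) {v : E} (hv : ‖v‖ < 1) :
    ‖u - w‖ * (1 - ‖v‖ ^ 2) ≤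
      ‖u - v‖ * ballCochord v w + ballCochord u v * ‖v - w‖ := by
  rcases eq_or_ne v 0 with rfl | hv0
  · have hc (w : E) : ballCochord w 0 = 1 := by simp [ballCochord]
    rw [ballCochord_comm, hc, hc]
    simpa using norm_sub_le u w
  have hn : 0 < ‖v‖ := norm_pos_iff.2 hv0
  have hinv : ‖v‖ * dist v ((‖v‖ ^ 2)⁻¹ • v) = 1 - ‖v‖ ^ 2 := by
    have hp := one_sub_norm_sq_pos hv
    rw [← ballCochord_eq_norm_mul_dist v hv0, ballCochord, sub_self, norm_zero,
      zero_pow two_ne_zero, add_zero, Real.sqrt_mul_self hp.le]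
  have hpt := EuclideanGeometry.mul_dist_le_mul_dist_add_mul_dist u v w ((‖v‖ ^ 2)⁻¹ • v)
  rw [ballCochord_comm v w, ballCochord_eq_norm_mul_dist u hv0, ballCochord_eq_norm_mul_dist w hv0,
    ← hinv, ← dist_eq_norm, ← dist_eq_norm, ← dist_eq_norm]
  nlinarith [mul_le_mul_of_nonneg_left hpt hn.le]

theorem arsinh_ballChord_triangle {u v w : E} (hu : ‖u‖ < 1) (hv : ‖v‖ < 1) (hw : ‖w‖ < 1) :
    Real.arsinh (ballChord u w) ≤
      Real.arsinh (ballChord u v) + Real.arsinh (ballChord v w) := by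
  rw [← Real.sinh_le_sinh, Real.sinh_add]
  simp only [Real.sinh_arsinh, Real.cosh_arsinh, sqrt_one_add_ballChord_sq hu hv,
    sqrt_one_add_ballChord_sq hv hw]
  have hpu := one_sub_norm_sq_pos hu
  have hpv := one_sub_norm_sq_pos hv
  have hpw := one_sub_norm_sq_pos hw
  unfold ballChord
  rw [Real.sqrt_mul hpu.le, Real.sqrt_mul hpu.le, Real.sqrt_mul hpv.le]
  have h := norm_sub_mul_le_ballCochord u w hv
  have hsu := Real.sqrt_pos.2 hpu
  have hsv := Real.sqrt_pos.2 hpv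
  have hsw := Real.sqrt_pos.2 hpw
  have hsq := Real.sq_sqrt hpv.le
  set a := √(1 - ‖u‖ ^ 2)
  set b := √(1 - ‖v‖ ^ 2)
  set c := √(1 - ‖w‖ ^ 2)
  have e : ‖u - v‖ / (a * b) * (ballCochord v w / (b * c)) +
      ballCochord u v / (a * b) * (‖v - w‖ / (b * c)) =
      (‖u - v‖ * ballCochord v w + ballCochord u v * ‖v - w‖) / (a * c * b ^ 2) := by
    field_simp
  rw [e, div_le_div_iff₀ (by positivity) (by positivity), hsq]
  nlinarith [mul_le_mul_of_nonneg_right h (mul_pos hsu hsw).le]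

/-- The ball is homogeneous: inversion in the sphere about `o / ‖o‖²` orthogonal to the unit sphere
preserves the chord and moves `0` to `o`. -/
theorem exists_ballChord_isometry {o : E} (ho : ‖o‖ < 1) :
    ∃ f : E → E, (∀ u, ‖u‖ < 1 → ‖f u‖ < 1) ∧ f 0 = o ∧
      ∀ u v, ‖u‖ < 1 → ‖v‖ < 1 → ballChord (f u) (f v) = ballChord u v := by
  rcases eq_or_ne o 0 with rfl | ho0
  · exact ⟨id, fun _ h => h, rfl, fun _ _ _ _ => rfl⟩
  have hn : 0 < ‖o‖ := norm_pos_iff.2 ho0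
  set c : E := (‖o‖ ^ 2)⁻¹ • o with hc
  have hcn : ‖c‖ = ‖o‖⁻¹ := by
    rw [hc, norm_smul, norm_inv, norm_pow, norm_norm]; field_simp
  have hc1 : 1 < ‖c‖ := by rw [hcn]; exact (one_lt_inv₀ hn).2 ho
  have hr : 0 < ‖c‖ ^ 2 - 1 := by nlinarith
  set r : ℝ := √(‖c‖ ^ 2 - 1) with hrdef
  have hr2 : r ^ 2 = ‖c‖ ^ 2 - 1 := Real.sq_sqrt hr.le
  have hne : ∀ u : E, ‖u‖ < 1 → u ≠ c := by
    rintro u hu rfl; linarith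
  have hdist : ∀ u : E, ‖u‖ < 1 → 0 < dist u c := fun u hu => dist_pos.2 (hne u hu)
  have hcompl : ∀ u : E, ‖u‖ < 1 → 1 - ‖EuclideanGeometry.inversion c r u‖ ^ 2 =
      r ^ 2 / dist u c ^ 2 * (1 - ‖u‖ ^ 2) := by
    intro u hu
    have hd := hdist u hu
    rw [EuclideanGeometry.inversion, vsub_eq_sub, vadd_eq_add, norm_add_sq_real, norm_smul,
      inner_smul_left, mul_pow, ← dist_eq_norm]
    have h1 : ‖u‖ ^ 2 = dist u c ^ 2 + 2 * inner ℝ (u - c) c + ‖c‖ ^ 2 := by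
      rw [dist_eq_norm, ← norm_add_sq_real, sub_add_cancel]
    rw [h1]
    simp only [Real.norm_eq_abs, sq_abs, conj_trivial, div_pow]
    have h2 : ‖c‖ ^ 2 = r ^ 2 + 1 := by linarith
    rw [h2]
    field_simp
    ring
  refine ⟨EuclideanGeometry.inversion c r, fun u hu => ?_, ?_, fun u v hu hv => ?_⟩
  · have h := hcompl u hu
    have : 0 < r ^ 2 / dist u c ^ 2 * (1 - ‖u‖ ^ 2) :=
      mul_pos (div_pos (by linarith) (pow_pos (hdist u hu) 2)) (one_sub_norm_sq_pos hu)
    rw [← h] at this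
    nlinarith [norm_nonneg (EuclideanGeometry.inversion c r u)]
  · rw [EuclideanGeometry.inversion, vsub_eq_sub, vadd_eq_add, dist_zero_left, div_pow, hr2, hcn,
      hc, zero_sub, smul_neg, ← neg_smul, smul_smul, ← add_smul]
    have : (-((‖o‖⁻¹ ^ 2 - 1) / ‖o‖⁻¹ ^ 2) * (‖o‖ ^ 2)⁻¹ + (‖o‖ ^ 2)⁻¹) = 1 := by
      field_simp; ring
    rw [this, one_smul]
  · have hdu := hdist u hu
    have hdv := hdist v hv
    have hrp : 0 < r ^ 2 := by linarith
    unfold ballChord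
    rw [hcompl u hu, hcompl v hv, ← dist_eq_norm,
      EuclideanGeometry.dist_inversion_inversion (hne u hu) (hne v hv), ← dist_eq_norm]
    have e : r ^ 2 / dist u c ^ 2 * (1 - ‖u‖ ^ 2) * (r ^ 2 / dist v c ^ 2 * (1 - ‖v‖ ^ 2)) =
        (r ^ 2 / (dist u c * dist v c)) ^ 2 * ((1 - ‖u‖ ^ 2) * (1 - ‖v‖ ^ 2)) := by
      field_simp
    rw [e, Real.sqrt_mul (sq_nonneg _), Real.sqrt_sq (by positivity)]
    exact mul_div_mul_left _ _ (by positivity)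

end Chord

/-! ### Geodesic distances on the product -/

/-- In units of the ball radius, the hyperbolic distance is `2 / √(-c) * arsinh` of the chord. -/
theorem hypDist_eq_arsinh_ballChord {n : ℕ} {c : ℝ} (hc : c < 0) (x y : HypSpace n c) :
    hypDist x y = 2 / √(-c) * Real.arsinh (ballChord (√(-c) • x.1) (√(-c) • y.1)) := by
  have hk : √(-c) ^ 2 = -c := Real.sq_sqrt (by linarith)
  unfold hypDist ballChord
  rw [← smul_sub, norm_smul, norm_smul, norm_smul, Real.norm_of_nonneg (Real.sqrt_nonneg _),
    mul_pow, mul_pow, hk]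
  simp only [neg_mul, sub_neg_eq_add]

theorem norm_sqrt_smul_lt_one {n : ℕ} {c : ℝ} (hc : c < 0) (x : HypSpace n c) :
    ‖√(-c) • x.1‖ < 1 := by
  have hk : 0 < √(-c) := Real.sqrt_pos.2 (by linarith)
  rw [norm_smul, Real.norm_of_nonneg hk.le, mul_comm]
  exact (lt_div_iff₀ hk).1 x.2

theorem hypDist_nonneg {n : ℕ} {c : ℝ} (hc : c < 0) (x y : HypSpace n c) : 0 ≤ hypDist x y := by
  rw [hypDist_eq_arsinh_ballChord hc]
  exact mul_nonneg (by positivity) (Real.arsinh_nonneg_iff.2 (ballChord_nonneg _ _))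

theorem hypDist_self {n : ℕ} {c : ℝ} (x : HypSpace n c) : hypDist x x = 0 := by
  simp [hypDist]

theorem hypDist_comm {n : ℕ} {c : ℝ} (x y : HypSpace n c) : hypDist x y = hypDist y x := by
  unfold hypDist; rw [norm_sub_rev, mul_comm (1 + c * ‖x.1‖ ^ 2)]

theorem hypDist_triangle {n : ℕ} {c : ℝ} (hc : c < 0) (x y z : HypSpace n c) :
    hypDist x z ≤ hypDist x y + hypDist y z := by
  simp only [hypDist_eq_arsinh_ballChord hc, ← mul_add]
  exact mul_le_mul_of_nonneg_left (arsinh_ballChord_triangle (norm_sqrt_smul_lt_one hc x)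
    (norm_sqrt_smul_lt_one hc y) (norm_sqrt_smul_lt_one hc z)) (by positivity)

theorem sphDist_nonneg {n : ℕ} {c : ℝ} (x y : SphSpace n c) : 0 ≤ sphDist x y :=
  mul_nonneg (by positivity) (InnerProductGeometry.angle_nonneg _ _)

theorem sphDist_comm {n : ℕ} {c : ℝ} (x y : SphSpace n c) : sphDist x y = sphDist y x := by
  unfold sphDist; rw [InnerProductGeometry.angle_comm]

theorem sphDist_triangle {n : ℕ} {c : ℝ} (x y z : SphSpace n c) :
    sphDist x z ≤ sphDist x y + sphDist y z := by
  simp only [sphDist, ← mul_add]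
  exact mul_le_mul_of_nonneg_left (InnerProductGeometry.angle_le_angle_add_angle _ _ _)
    (by positivity)

/-- Two points of a geodesic ball of radius `R` are at distance at most `2 R`. -/
theorem prodDist_le_two_mul {dE dH dS : ℕ} {cH cS R : ℝ} (hcH : cH < 0) (hR : 0 ≤ R)
    {o x y : ProdSpace dE dH dS cH cS} (hx : prodDist o x ≤ R) (hy : prodDist o y ≤ R) :
    prodDist x y ≤ 2 * R := by
  unfold prodDist at *
  rw [Real.sqrt_le_left hR] at hx hy
  rw [Real.sqrt_le_left (by positivity)]
  have key : ∀ a b t : ℝ, 0 ≤ t → t ≤ a + b → t ^ 2 ≤ 2 * a ^ 2 + 2 * b ^ 2 := by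
    intro a b t ht h
    nlinarith [sq_nonneg (a - b), pow_le_pow_left₀ ht h 2]
  have h1 := key (dist o.1 x.1) (dist o.1 y.1) (dist x.1 y.1) dist_nonneg (dist_triangle_left _ _ _)
  have h2 := key (hypDist o.2.1 x.2.1) (hypDist o.2.1 y.2.1) (hypDist x.2.1 y.2.1)
    (hypDist_nonneg hcH _ _)
    (by rw [hypDist_comm o.2.1 x.2.1]; exact hypDist_triangle hcH _ _ _)
  have h3 := key (sphDist o.2.2 x.2.2) (sphDist o.2.2 y.2.2) (sphDist x.2.2 y.2.2)
    (sphDist_nonneg _ _)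
    (by rw [sphDist_comm o.2.2 x.2.2]; exact sphDist_triangle _ _ _)
  linarith

/-- On a spherical slice the product distance is the spherical distance. -/
theorem prodDist_sphere_slice {dE dH dS : ℕ} {cH cS : ℝ} (e : EuclideanSpace ℝ (Fin dE))
    (h : HypSpace dH cH) (s s' : SphSpace dS cS) :
    prodDist (e, h, s) (e, h, s') = sphDist s s' := by
  simp [prodDist, hypDist_self, Real.sqrt_sq (sphDist_nonneg s s')]

/-! ### Exponentially many separated points in a hyperbolic ball -/

/-- With `r = tanh t`, the points `(√(1 - (i / n)²), i / n)` on the circle of Euclidean radius `r` have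
mutual Euclidean distance at least `r / n`, which the conformal factor `cosh² t` turns into a
chord of at least `1`. -/
theorem exists_separated_ball_points {d : ℕ} (hd : 2 ≤ d) {t : ℝ} (ht : 0 ≤ t) {n : ℕ}
    (hn : (n : ℝ) ≤ Real.sinh t * Real.cosh t) :
    ∃ P : Fin (n + 1) → EuclideanSpace ℝ (Fin d), (∀ i, ‖P i‖ < 1) ∧
      (∀ i, ballChord 0 (P i) = Real.sinh t) ∧ ∀ i j, i ≠ j → 1 ≤ ballChord (P i) (P j) := by
  have hch := Real.cosh_pos t
  have hsh : 0 ≤ Real.sinh t := Real.sinh_nonneg_iff.2 ht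
  have hcs := Real.cosh_sq t
  obtain ⟨r, hr⟩ : ∃ r : ℝ, r = Real.sinh t / Real.cosh t := ⟨_, rfl⟩
  have hr0 : 0 ≤ r := by rw [hr]; positivity
  have hcompl : 1 - r ^ 2 = (Real.cosh t ^ 2)⁻¹ := by
    rw [hr]; field_simp; linarith
  let i₀ : Fin d := ⟨0, by omega⟩
  let i₁ : Fin d := ⟨1, by omega⟩
  have h01 : i₀ ≠ i₁ := by simp [i₀, i₁]
  let q : Fin (n + 1) → ℝ := fun i => (i : ℕ) / n
  let P : Fin (n + 1) → EuclideanSpace ℝ (Fin d) := fun i =>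
    r • (EuclideanSpace.single i₀ √(1 - q i ^ 2) + EuclideanSpace.single i₁ (q i))
  have hq0 : ∀ i, 0 ≤ q i := fun i => by positivity
  have hq1 : ∀ i, q i ≤ 1 := fun i => by
    apply div_le_one_of_le₀ _ (by positivity)
    exact_mod_cast Nat.lt_succ_iff.1 i.2
  have hnorm : ∀ i, ‖P i‖ = r := by
    intro i
    have h : 0 ≤ 1 - q i ^ 2 := by nlinarith [hq0 i, hq1 i]
    have : ‖EuclideanSpace.single i₀ √(1 - q i ^ 2) + EuclideanSpace.single i₁ (q i)‖ ^ 2 = 1 := by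
      rw [norm_add_sq_real]
      simp [EuclideanSpace.inner_single_left, h01, Real.sq_sqrt h]
    rw [norm_smul, Real.norm_of_nonneg hr0,
      (pow_eq_one_iff_of_nonneg (norm_nonneg _) two_ne_zero).1 this, mul_one]
  have hr1 : r < 1 := by rw [hr, div_lt_one hch]; exact Real.sinh_lt_cosh t
  refine ⟨P, fun i => by rw [hnorm]; exact hr1, fun i => ?_, fun i j hij => ?_⟩
  · rw [ballChord, zero_sub, norm_neg, hnorm, norm_zero, hcompl]
    simp only [ne_eq, OfNat.ofNat_ne_zero, not_false_eq_true, zero_pow, sub_zero, one_mul]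
    rw [Real.sqrt_inv, Real.sqrt_sq hch.le, hr]
    field_simp
  · have hn0 : 0 < n := by
      rcases Nat.eq_zero_or_pos n with rfl | h
      · exact absurd (Fin.ext (by omega)) hij
      · exact h
    have hn0' : (0 : ℝ) < n := Nat.cast_pos.2 hn0
    have hint : (1 : ℝ) ≤ |((i : ℕ) : ℝ) - ((j : ℕ) : ℝ)| := by
      have hne : ((i : ℕ) : ℤ) - ((j : ℕ) : ℤ) ≠ 0 := by
        rw [sub_ne_zero]; exact_mod_cast fun h => hij (Fin.ext h)
      exact_mod_cast Int.one_le_abs hne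
    have hcoord : r * |((i : ℕ) : ℝ) - ((j : ℕ) : ℝ)| / n ≤ ‖P i - P j‖ := by
      refine le_trans (le_of_eq ?_) (PiLp.norm_apply_le (P i - P j) i₁)
      simp only [P, q, PiLp.sub_apply, PiLp.smul_apply, PiLp.add_apply, PiLp.single_apply,
        h01.symm, if_false, if_true, smul_eq_mul, zero_add, Real.norm_eq_abs]
      rw [← mul_sub, ← sub_div, abs_mul, abs_div, abs_of_nonneg hr0, abs_of_pos hn0', mul_div_assoc]
    rw [ballChord, hnorm, hnorm, hcompl, Real.sqrt_mul_self (by positivity), div_inv_eq_mul]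
    calc (1 : ℝ) ≤ Real.sinh t * Real.cosh t / n := (one_le_div hn0').2 hn
      _ = r * 1 / n * Real.cosh t ^ 2 := by rw [hr]; field_simp
      _ ≤ r * |((i : ℕ) : ℝ) - ((j : ℕ) : ℝ)| / n * Real.cosh t ^ 2 := by gcongr
      _ ≤ _ := by gcongr

/-- A hyperbolic ball of radius `a` contains at least `e ^ (√(-c) a) / 8` points at mutual distance at
least `2 arsinh 1 / √(-c)`. -/
theorem exists_separated_hypDist {d : ℕ} (hd : 2 ≤ d) {c : ℝ} (hc : c < 0) (o : HypSpace d c)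
    {a : ℝ} (ha : 1 ≤ √(-c) * a) :
    ∃ (n : ℕ) (P : Fin (n + 1) → HypSpace d c),
      1 / 8 * Real.exp (√(-c) * a) ≤ ((n + 1 : ℕ) : ℝ) ∧ (∀ i, hypDist o (P i) ≤ a) ∧
      ∀ i j, i ≠ j → 2 / √(-c) * Real.arsinh 1 ≤ hypDist (P i) (P j) := by
  have hk : 0 < √(-c) := Real.sqrt_pos.2 (by linarith)
  set k := √(-c) with hkdef
  set t : ℝ := k * a / 2 with ht
  have ht0 : 0 ≤ t := by rw [ht]; linarith
  have hsc : Real.sinh t * Real.cosh t = Real.sinh (k * a) / 2 := by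
    have : k * a = 2 * t := by rw [ht]; ring
    rw [this, Real.sinh_two_mul]; ring
  have hnonneg : 0 ≤ Real.sinh t * Real.cosh t :=
    mul_nonneg (Real.sinh_nonneg_iff.2 ht0) (Real.cosh_pos t).le
  obtain ⟨P, hP1, hP0, hPsep⟩ := exists_separated_ball_points hd ht0 (Nat.floor_le hnonneg)
  obtain ⟨f, hf1, hf0, hf⟩ := exists_ballChord_isometry (norm_sqrt_smul_lt_one hc o)
  have hmem : ∀ i, ‖k⁻¹ • f (P i)‖ < 1 / k := by
    intro i
    rw [norm_smul, norm_inv, Real.norm_of_nonneg hk.le, one_div]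
    exact mul_lt_of_lt_one_right (inv_pos.2 hk) (hf1 _ (hP1 i))
  refine ⟨⌊Real.sinh t * Real.cosh t⌋₊, fun i => ⟨k⁻¹ • f (P i), hmem i⟩, ?_, fun i => ?_,
    fun i j hij => ?_⟩
  · refine le_trans ?_ (le_of_lt (by exact_mod_cast Nat.lt_floor_add_one _))
    rw [hsc, Real.sinh_eq]
    have h1 : 2 ≤ Real.exp (k * a) := by linarith [Real.add_one_le_exp (k * a)]
    have h2 : Real.exp (-(k * a)) ≤ 1 := Real.exp_le_one_iff.2 (by linarith)
    linarith
  · rw [hypDist_eq_arsinh_ballChord hc]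
    change 2 / k * Real.arsinh (ballChord (k • o.1) (k • k⁻¹ • f (P i))) ≤ a
    rw [smul_inv_smul₀ hk.ne', ← hf0,
      hf _ _ (by simp) (hP1 i), hP0, Real.arsinh_sinh, ht]
    apply le_of_eq; field_simp
  · rw [hypDist_eq_arsinh_ballChord hc]
    change _ ≤ 2 / k * Real.arsinh (ballChord (k • k⁻¹ • f (P i)) (k • k⁻¹ • f (P j)))
    rw [smul_inv_smul₀ hk.ne', smul_inv_smul₀ hk.ne',
      hf _ _ (hP1 i) (hP1 j)]
    exact mul_le_mul_of_nonneg_left (Real.arsinh_le_arsinh.2 (hPsep i j hij)) (by positivity)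

/-! ### Closed polygons with long diagonals -/

/-- If two vectors of norm at least `ρ` make an angle of at least `φ`, then they are as far apart as
two vectors of norm `ρ` at angle `φ`. -/
theorem two_mul_sin_half_le_norm_sub {V : Type*} [NormedAddCommGroup V] [InnerProductSpace ℝ V]
    {u v : V} {ρ φ : ℝ} (hρ : 0 ≤ ρ) (hu : ρ ≤ ‖u‖) (hv : ρ ≤ ‖v‖) (hφ : 0 ≤ φ)
    (h : φ ≤ InnerProductGeometry.angle u v) :
    2 * (ρ * Real.sin (φ / 2)) ≤ ‖u - v‖ := by
  apply le_of_sq_le_sq _ (norm_nonneg _)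
  have hcos : Real.cos (InnerProductGeometry.angle u v) ≤ Real.cos φ :=
    Real.cos_le_cos_of_nonneg_of_le_pi hφ (InnerProductGeometry.angle_le_pi _ _) h
  have hsq : Real.sin (φ / 2) ^ 2 = (1 - Real.cos φ) / 2 := by
    rw [Real.sin_sq_eq_half_sub]; ring_nf
  rw [norm_sub_sq_real, ← InnerProductGeometry.cos_angle_mul_norm_mul_norm, mul_pow, mul_pow, hsq]
  have huv : ρ ^ 2 ≤ ‖u‖ * ‖v‖ := by nlinarith
  have h1 := Real.cos_le_one φ
  nlinarith [sq_nonneg (‖u‖ - ‖v‖), mul_le_mul_of_nonneg_right huv (sub_nonneg.2 h1),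
    mul_le_mul_of_nonneg_right hcos (by positivity : 0 ≤ ‖u‖ * ‖v‖)]

/-- The diagonals `f j - f (j + h)` of a closed `2 h`-gon turn by the angle `π` in `h` steps, so one
of the steps turns by at least `π / h`. -/
theorem mul_sin_le_of_closed_polygon {V : Type*} [NormedAddCommGroup V] [InnerProductSpace ℝ V]
    (f : ℕ → V) {h : ℕ} (hh : 0 < h) {ρ s : ℝ} (hρ : 0 < ρ) (hclosed : f (h + h) = f 0)
    (hdiag : ∀ j, ρ ≤ ‖f j - f (j + h)‖) (hstep : ∀ j, ‖f j - f (j + 1)‖ ≤ s) :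
    ρ * Real.sin (Real.pi / h / 2) ≤ s := by
  set g : ℕ → V := fun j => f j - f (j + h) with hg
  have hh' : (0 : ℝ) < h := Nat.cast_pos.2 hh
  have hg0 : g 0 ≠ 0 := norm_pos_iff.1 (hρ.trans_le (hdiag 0))
  have hgh : g h = -g 0 := by simp [hg, hclosed]
  obtain ⟨j, hj⟩ : ∃ j, Real.pi / h ≤ InnerProductGeometry.angle (g j) (g (j + 1)) := by
    by_contra! hlt
    have hsum : ∀ n : ℕ, 0 < n → InnerProductGeometry.angle (g 0) (g n) < n * (Real.pi / h) := by
      intro n hn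
      induction n, hn using Nat.le_induction with
      | base => simpa using hlt 0
      | succ n _ ih =>
        have := InnerProductGeometry.angle_le_angle_add_angle (g 0) (g n) (g (n + 1))
        have := hlt n
        push_cast
        linarith
    have := hsum h hh
    rw [hgh, InnerProductGeometry.angle_self_neg_of_nonzero hg0, mul_div_cancel₀ _ hh'.ne'] at this
    exact lt_irrefl _ this
  have h1 := two_mul_sin_half_le_norm_sub hρ.le (hdiag j) (hdiag (j + 1)) (by positivity) hj
  have h2 : ‖g j - g (j + 1)‖ ≤ s + s := by
    have e : g j - g (j + 1) = (f j - f (j + 1)) - (f (j + h) - f (j + h + 1)) := by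
      simp only [hg, add_right_comm j 1 h]; abel
    rw [e]
    exact (norm_sub_le _ _).trans (add_le_add (hstep j) (hstep (j + h)))
  linarith

/-! ### Distortion of the sphere -/

/-- A great circle through equally spaced points: successive points are at distance `r π / h`, points
`h` steps apart are antipodal. -/
theorem exists_great_circle_polygon {n : ℕ} (hn : 1 ≤ n) {c : ℝ} (hc : 0 < c) {h : ℕ}
    (hh : 0 < h) :
    ∃ p : ℕ → SphSpace n c, p (h + h) = p 0 ∧
      (∀ j, sphDist (p j) (p (j + h)) = 1 / √c * Real.pi) ∧
      ∀ j, sphDist (p j) (p (j + 1)) = 1 / √c * (Real.pi / h) := by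
  have hh' : (0 : ℝ) < h := Nat.cast_pos.2 hh
  have hr : 0 < 1 / √c := by positivity
  set r := 1 / √c with hrdef
  have hr2 : r * r = 1 / c := by rw [hrdef, div_mul_div_comm, Real.mul_self_sqrt hc.le, one_mul]
  let i₀ : Fin (n + 1) := ⟨0, by omega⟩
  let i₁ : Fin (n + 1) := ⟨1, by omega⟩
  have h01 : i₀ ≠ i₁ := by simp [i₀, i₁]
  let q : ℝ → EuclideanSpace ℝ (Fin (n + 1)) := fun θ =>
    EuclideanSpace.single i₀ (r * Real.cos θ) + EuclideanSpace.single i₁ (r * Real.sin θ)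
  have hinner : ∀ θ τ, inner ℝ (q θ) (q τ) = 1 / c * Real.cos (θ - τ) := by
    intro θ τ
    simp only [q, inner_add_left, inner_add_right, EuclideanSpace.inner_single_left,
      PiLp.single_apply, h01, h01.symm, if_true, if_false, conj_trivial, Real.cos_sub, ← hr2]
    ring
  have hmem : ∀ θ, inner ℝ (q θ) (q θ) = 1 / c := fun θ => by rw [hinner]; simp
  have hnorm : ∀ θ, ‖q θ‖ * ‖q θ‖ = 1 / c := fun θ => by
    rw [← real_inner_self_eq_norm_mul_norm, hmem]
  have hangle : ∀ θ τ, 0 ≤ τ → τ ≤ Real.pi →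
      InnerProductGeometry.angle (q θ) (q (θ + τ)) = τ := by
    intro θ τ h0 hπ
    have hn : ‖q (θ + τ)‖ = ‖q θ‖ := by
      rw [← mul_self_inj_of_nonneg (norm_nonneg _) (norm_nonneg _), hnorm, hnorm]
    rw [InnerProductGeometry.angle, hinner, hn, hnorm, mul_div_cancel_left₀ _ (by positivity),
      sub_add_cancel_left, Real.cos_neg, Real.arccos_cos h0 hπ]
  refine ⟨fun j => ⟨q (j * (Real.pi / h)), hmem _⟩, ?_, fun j => ?_, fun j => ?_⟩
  · apply Subtype.ext
    have e : ((h + h : ℕ) : ℝ) * (Real.pi / h) = 2 * Real.pi := by push_cast; field_simp; ring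
    simp only [e, q]
    simp
  · have e : ((j + h : ℕ) : ℝ) * (Real.pi / h) = j * (Real.pi / h) + Real.pi := by
      push_cast; field_simp
    simp only [sphDist, e, hangle _ _ Real.pi_pos.le le_rfl, ← hrdef]
  · have e : ((j + 1 : ℕ) : ℝ) * (Real.pi / h) = j * (Real.pi / h) + Real.pi / h := by
      push_cast; ring
    have hle : Real.pi / h ≤ Real.pi := div_le_self Real.pi_pos.le (by exact_mod_cast hh)
    simp only [sphDist, e, hangle _ _ (by positivity) hle, ← hrdef]

/-- Since `sin x / x → 1`, half the perimeter of a regular `2 h`-gon exceeds `η < π / 2` times its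
diameter for some `h`. -/
theorem exists_mul_pi_div_lt_pi_mul_sin {η : ℝ} (hη : η < Real.pi / 2) :
    ∃ h : ℕ, 0 < h ∧ η * (Real.pi / h) < Real.pi * Real.sin (Real.pi / h / 2) := by
  have hlim : Tendsto (fun h : ℕ => Real.pi / 2 * Real.sinc (Real.pi / h / 2)) atTop
      (𝓝 (Real.pi / 2)) := by
    have h1 : Tendsto (fun h : ℕ => Real.pi / (h : ℝ) / 2) atTop (𝓝 0) := by
      simpa using (tendsto_const_div_atTop_nhds_zero_nat Real.pi).div_const 2
    have h2 := (Real.continuous_sinc.tendsto 0).comp h1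
    simpa using h2.const_mul (Real.pi / 2)
  obtain ⟨h, hh, hpos⟩ := ((hlim.eventually_const_lt hη).and (eventually_gt_atTop 0)).exists
  refine ⟨h, hpos, ?_⟩
  have hh' : (0 : ℝ) < h := Nat.cast_pos.2 hpos
  have hx : 0 < Real.pi / h := by positivity
  rw [Real.sinc_of_ne_zero (by positivity)] at hh
  have := mul_lt_mul_of_pos_right hh hx
  refine this.trans_eq ?_
  field_simp

/-- For a map that does not contract the distances of a spherical slice, a multiplicative constant
`β < η < π / 2` costs an additive distortion `σ` that does not depend on the map. -/
theorem exists_additive_distortion_of_sphNoncontracting (dE dH dS m : ℕ) (cH : ℝ) {cS η : ℝ}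
    (hcS : 0 < cS) (hη : η < Real.pi / 2) :
    ∃ σ : ℝ, 0 < σ ∧ ∀ (𝓜 : Set (ProdSpace dE dH dS cH cS)) (Φ : 𝓜 → EuclideanSpace ℝ (Fin m))
      (β ε : ℝ), IsDistortion (dataDist 𝓜) dist Φ β ε → SphNoncontracting Φ → η ≤ β ∨ σ ≤ ε := by
  obtain ⟨h, hh, hlt⟩ := exists_mul_pi_div_lt_pi_mul_sin hη
  have hr : 0 < 1 / √cS := by positivity
  refine ⟨1 / √cS * (Real.pi * Real.sin (Real.pi / h / 2) - η * (Real.pi / h)),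
    mul_pos hr (sub_pos.2 hlt), ?_⟩
  rintro 𝓜 Φ β ε ⟨-, -, hd⟩ ⟨hdS, e, x, hs, hΦ⟩
  obtain ⟨p, hclosed, hanti, hstep⟩ := exists_great_circle_polygon hdS hcS hh
  by_contra! hcon
  have key := mul_sin_le_of_closed_polygon (fun j => Φ ⟨(e, x, p j), hs (p j)⟩) hh
    (mul_pos hr Real.pi_pos) (by simp only [hclosed])
    (fun j => by
      rw [← dist_eq_norm, ← hanti j]
      exact hΦ _ _)
    (s := β * (1 / √cS * (Real.pi / h)) + ε)
    (fun j => by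
      rw [← dist_eq_norm]
      refine (hd _ _).trans_eq ?_
      rw [dataDist, prodDist_sphere_slice, hstep])
  have : 0 ≤ 1 / √cS * (Real.pi / h) := by positivity
  nlinarith [mul_le_mul_of_nonneg_right hcon.1.le this]

/-! ### Distortion forced by exponentially many separated images -/

/-- Beyond some radius, `A e ^ (γ R)` separated images do not fit into a Euclidean set whose diameter
is quadratic in `R`. -/
theorem exists_radius_of_separated (dE dH dS m : ℕ) {cH A γ Δ : ℝ} (cS : ℝ) (hcH : cH < 0)
    (hA : 0 < A) (hγ : 0 < γ) (hΔ : 0 < Δ) :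
    ∃ R₀ : ℝ, 0 < R₀ ∧ ∀ (R : ℝ) (𝓜 : Set (ProdSpace dE dH dS cH cS))
      (Φ : 𝓜 → EuclideanSpace ℝ (Fin m)) (β ε : ℝ), R₀ ≤ R → InGeodesicBall 𝓜 R →
      IsDistortion (dataDist 𝓜) dist Φ β ε → UniformlySeparates Φ A γ Δ R →
      1 + R ≤ β ∨ R ≤ ε := by
  obtain ⟨R₀, h0⟩ := eventually_atTop.1 (eventually_packing_bound_lt_exp m hA hγ hΔ)
  refine ⟨max R₀ 1, by positivity, ?_⟩
  rintro R 𝓜 Φ β ε hR ⟨o, ho⟩ ⟨hβ, hε, hd⟩ ⟨T, hT, hsep⟩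
  by_contra! hcon
  have hR1 : 0 < R := zero_lt_one.trans_le ((le_max_right _ _).trans hR)
  have hcard := card_le_of_separated_of_dist_le T Φ (D := (1 + R) * (2 * R) + R) hΔ (by positivity)
    hsep (fun u _ v _ => by
      refine (hd u v).trans (add_le_add ?_ hcon.2.le)
      exact mul_le_mul hcon.1.le (prodDist_le_two_mul hcH hR1.le (ho _ u.2) (ho _ v.2))
        (Real.sqrt_nonneg _) (by positivity))
  exact absurd (hT.trans hcard) (not_le.2 (h0 R ((le_max_left _ _).trans hR)))

/-- A co-Lipschitz map of a hyperbolic ball keeps exponentially many points uniformly separated. -/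
theorem HypCoLipschitz.uniformlySeparates {dE dH dS m : ℕ} {cH cS : ℝ} (hcH : cH < 0)
    {𝓜 : Set (ProdSpace dE dH dS cH cS)} {Φ : 𝓜 → EuclideanSpace ℝ (Fin m)} {ρ α₀ R : ℝ}
    (hα₀ : 0 < α₀) (hR : 1 ≤ √(-cH) * (ρ * R)) (h : HypCoLipschitz Φ ρ α₀ R) :
    UniformlySeparates Φ (1 / 8) (√(-cH) * ρ) (α₀⁻¹ * (2 / √(-cH) * Real.arsinh 1)) R := by
  classical
  obtain ⟨hdH, e, o, s, hmem, hco⟩ := h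
  obtain ⟨n, P, hn, hball, hsep⟩ := exists_separated_hypDist hdH hcH o hR
  have hk : 0 < √(-cH) := Real.sqrt_pos.2 (by linarith)
  have hpos : 0 < 2 / √(-cH) * Real.arsinh 1 :=
    mul_pos (by positivity) (Real.arsinh_pos_iff.2 one_pos)
  let Q : Fin (n + 1) → 𝓜 := fun i => ⟨(e, P i, s), hmem _ (hball i)⟩
  have hQ : Function.Injective Q := by
    intro i j hij
    by_contra hne
    have hP : P i = P j := congrArg (fun x : 𝓜 => x.1.2.1) hij
    have := hsep i j hne
    rw [hP, hypDist_self] at this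
    linarith
  refine ⟨Finset.univ.image Q, ?_, ?_⟩
  · rw [Finset.card_image_of_injective _ hQ, Finset.card_univ, Fintype.card_fin, mul_assoc]
    exact hn
  · intro u hu v hv huv
    obtain ⟨i, -, rfl⟩ := Finset.mem_image.1 hu
    obtain ⟨j, -, rfl⟩ := Finset.mem_image.1 hv
    refine le_trans ?_ (hco _ _ _ _ (hball i) (hball j))
    exact mul_le_mul_of_nonneg_left (hsep i j fun hij => huv (congrArg Q hij)) (by positivity)

/-! ### Comparison of the risk bounds -/

theorem theorem2 (dE dH dS m : ℕ) (cH cS : ℝ) (hcH : cH < 0) (hcS : 0 < cS)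
    (A γ Δ ρ α₀ η : ℝ) (hA : 0 < A) (hγ : 0 < γ) (hΔ : 0 < Δ) (hρ : 0 < ρ) (hα₀ : 0 < α₀)
    (hη₁ : 1 < η) (hη₂ : η < Real.pi / 2) :
    ∃ R₀ : ℝ, 0 < R₀ ∧ ∃ σ : ℝ, 0 < σ ∧
      ∀ (R : ℝ) (𝓜 : Set (ProdSpace dE dH dS cH cS)), MeasurableSet 𝓜 → InGeodesicBall 𝓜 R →
      ∀ (Y Θp Op Θe Oe : Type*) [Fintype Y] [MeasurableSpace Y] [MeasurableSingletonClass Y]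
        (μ : ProbabilityMeasure (𝓜 × Y)) (ν : ℕ → ProbabilityMeasure (𝓜 × Y))
        (Gprod : MatchingModel 𝓜 (ProdSpace dE dH dS cH cS) Y Θp Op)
        (Geuc : MatchingModel 𝓜 (EuclideanSpace ℝ (Fin m)) Y Θe Oe)
        (𝓕prod : TestClass (ProdSpace dE dH dS cH cS) prodDist)
        (𝓕euc : TestClass (EuclideanSpace ℝ (Fin m)) dist)
        (L C εstab εopt βeuc εeuc : ℝ) (Estat : Y → ℕ → ℝ) (N : ℕ),
        0 ≤ L → 0 < C → 0 ≤ εopt → (∀ y n, 0 ≤ Estat y n) →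
        Gprod.rep = Subtype.val →
        Gprod.Regular 𝓕prod μ ν L εstab εopt Estat →
        Geuc.Regular 𝓕euc μ ν L εstab εopt Estat →
        IsDistortion (dataDist 𝓜) dist Geuc.rep βeuc εeuc →
        0 < statError μ Estat εopt N →
        -- non-collapse of the Euclidean representation
        ((R₀ ≤ R ∧ (UniformlySeparates Geuc.rep A γ Δ R ∨ HypCoLipschitz Geuc.rep ρ α₀ R)) ∨
          SphNoncontracting Geuc.rep) →
        -- distortion constants in the product space and in the Euclidean space
        IsDistortion (dataDist 𝓜) prodDist Gprod.rep 1 0 ∧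
        (R₀ ≤ R ∧ (UniformlySeparates Geuc.rep A γ Δ R ∨ HypCoLipschitz Geuc.rep ρ α₀ R) →
          1 + R ≤ βeuc ∨ R ≤ εeuc) ∧
        (SphNoncontracting Geuc.rep → η ≤ βeuc ∨ σ ≤ εeuc) ∧
        -- both gaps obey their risk bounds, and the product bound is smaller by `L δ`
        Geuc.gap μ (ν N) ≤ riskBound L βeuc (statError μ Estat εopt N) C εeuc εstab ∧
        ∃ δ : ℝ, 0 < δ ∧
          (R₀ ≤ R ∧ (UniformlySeparates Geuc.rep A γ Δ R ∨ HypCoLipschitz Geuc.rep ρ α₀ R) →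
            R * min (statError μ Estat εopt N) C ≤ δ) ∧
          (SphNoncontracting Geuc.rep →
            min ((η - 1) * statError μ Estat εopt N) (σ * C) ≤ δ) ∧
          Gprod.gap μ (ν N) ≤ riskBound L 1 (statError μ Estat εopt N) C 0 εstab ∧
          riskBound L 1 (statError μ Estat εopt N) C 0 εstab
            ≤ riskBound L βeuc (statError μ Estat εopt N) C εeuc εstab - L * δ := by
  have hk : 0 < √(-cH) := Real.sqrt_pos.2 (by linarith)
  obtain ⟨R₁, hR₁, hsep⟩ := exists_radius_of_separated dE dH dS m cS hcH hA hγ hΔ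
  obtain ⟨R₂, -, hsep'⟩ := exists_radius_of_separated dE dH dS m cS hcH
    (by norm_num : (0 : ℝ) < 1 / 8) (mul_pos hk hρ)
    (mul_pos (inv_pos.2 hα₀)
      (mul_pos (div_pos two_pos hk) (Real.arsinh_pos_iff.2 one_pos)))
  obtain ⟨σ, hσ, hsph⟩ :=
    exists_additive_distortion_of_sphNoncontracting dE dH dS m cH hcS hη₂
  -- the third radius makes the co-Lipschitz balls at least as large as the curvature radius
  refine ⟨max (max R₁ R₂) (1 / (√(-cH) * ρ)), by positivity, σ, hσ, ?_⟩
  intro R 𝓜 _ hball Y Θp Op Θe Oe _ _ _ μ ν Gprod Geuc 𝓕prod 𝓕euc L C εstab εopt βeuc εeuc Estat N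
    hL hC _ _ hrep hprod heuc hdist hS hcases
  set S := statError μ Estat εopt N
  have hH : max (max R₁ R₂) (1 / (√(-cH) * ρ)) ≤ R ∧
      (UniformlySeparates Geuc.rep A γ Δ R ∨ HypCoLipschitz Geuc.rep ρ α₀ R) →
      0 < R ∧ (1 + R ≤ βeuc ∨ R ≤ εeuc) := by
    rintro ⟨hR, h⟩
    simp only [max_le_iff] at hR
    obtain ⟨⟨hR1, hR2⟩, hR3⟩ := hR
    refine ⟨hR₁.trans_le hR1, ?_⟩
    rcases h with h | h
    · exact hsep R 𝓜 _ _ _ hR1 hball hdist h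
    · refine hsep' R 𝓜 _ _ _ hR2 hball hdist (h.uniformlySeparates hcH hα₀ ?_)
      rw [div_le_iff₀ (by positivity)] at hR3
      linarith
  have hSph : SphNoncontracting Geuc.rep → η ≤ βeuc ∨ σ ≤ εeuc := hsph 𝓜 _ _ _ hdist
  obtain ⟨hβ, hε, -⟩ := hdist
  have hβS : 0 ≤ (βeuc - 1) * S := mul_nonneg (sub_nonneg.2 hβ) hS.le
  have hCε : 0 ≤ C * εeuc := mul_nonneg hC.le hε
  have hδH (h : max (max R₁ R₂) (1 / (√(-cH) * ρ)) ≤ R ∧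
      (UniformlySeparates Geuc.rep A γ Δ R ∨ HypCoLipschitz Geuc.rep ρ α₀ R)) :
      R * min S C ≤ (βeuc - 1) * S + C * εeuc := by
    obtain ⟨hR, h | h⟩ := hH h
    · nlinarith [mul_le_mul_of_nonneg_left (min_le_left S C) hR.le]
    · nlinarith [mul_le_mul_of_nonneg_left (min_le_right S C) hR.le]
  have hδS (h : SphNoncontracting Geuc.rep) :
      min ((η - 1) * S) (σ * C) ≤ (βeuc - 1) * S + C * εeuc := by
    rcases hSph h with h | h
    · exact (min_le_left _ _).trans (by nlinarith)
    · exact (min_le_right _ _).trans (by nlinarith)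
  refine ⟨⟨le_rfl, le_rfl, fun x y => by simp [hrep, dataDist]⟩, fun h => (hH h).2, hSph, ?_,
    (βeuc - 1) * S + C * εeuc, ?_, hδH, hδS, ?_, ?_⟩
  · refine (heuc.stable _ _).trans (le_add_of_nonneg_left (mul_nonneg hL ?_))
    have := mul_nonneg (zero_le_one.trans hβ) hS.le
    linarith
  · rcases hcases with h | h
    · exact (mul_pos (hH h).1 (lt_min hS hC)).trans_le (hδH h)
    · exact (lt_min (mul_pos (sub_pos.2 hη₁) hS) (mul_pos hσ hC)).trans_le (hδS h)
  · refine (hprod.stable _ _).trans (le_add_of_nonneg_left (mul_nonneg hL ?_))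
    linarith
  · unfold riskBound
    linarith
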